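/- Let $A\in\mathbb C^{n\times n}$, $B\in\mathbb C^{n\times m}$, and let $G\in\mathbb C^{n\times n}$, $\Gamma\in\mathbb C^{m\times m}$ be Hermitian with $\det\Gamma\neq 0$. Consider the Riccati inequality $$HA+A^{*}H+G-HB\Gamma^{-1}B^{*}H<0 \qquad (1)$$ for a Hermitian matrix $H\in\mathbb C^{n\times n}$, where $<0$ means negative definite; no sign condition is imposed on $\Gamma$. Assume that the pair $(A,\,B\Gamma^{-1}B^{*})$ is controllable, i.e. with $D=B\Gamma^{-1}B^{*}$ the matrix $[D,\,AD,\,\dots,\,A^{n-1}D]$ has rank $n$. (If $B$ has full column rank or $\Gamma$ is definite, this is the same as controllability of $(A,B)$.) If the Hamiltonian matrix $$R=\begin{pmatrix}A&-B\Gamma^{-1}B^{*}\\-G&-A^{*}\end{pmatrix}$$ has no eigenvalues on the imaginary axis, then (1) has a stabilizing solution $H_-$ and an anti-stabilizing solution $H_+$: both are Hermitian and satisfy (1), and all eigenvalues of $A-B\Gamma^{-1}B^{*}H_-$ and of $-(A-B\Gamma^{-1}B^{*}H_+)$ have negative real part (that is, these two matrices are Hurwitz). -/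

import Mathlib

open scoped Matrix ComplexOrder

namespace RiccatiInequality

/-- A square complex matrix is Hurwitz if all its eigenvalues have negative real part. -/
def IsHurwitz {n : ℕ} (M : Matrix (Fin n) (Fin n) ℂ) : Prop :=
  ∀ z ∈ spectrum ℂ M, z.re < 0

/-- The block matrix `[B, A B, A² B, …, Aⁿ⁻¹ B]`, whose columns are indexed by
(block, column of `B`). -/
def controllabilityMatrix {n m : ℕ} (A : Matrix (Fin n) (Fin n) ℂ)
    (B : Matrix (Fin n) (Fin m) ℂ) : Matrix (Fin n) (Fin n × Fin m) ℂ :=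
  Matrix.of fun i p => (A ^ (p.1 : ℕ) * B) i p.2

/-- The pair `(A, B)` is controllable: the controllability matrix has full row rank. -/
def IsControllable {n m : ℕ} (A : Matrix (Fin n) (Fin n) ℂ)
    (B : Matrix (Fin n) (Fin m) ℂ) : Prop :=
  (controllabilityMatrix A B).rank = n

/-- The Hamiltonian matrix `R = [A, -B Γ⁻¹ B*; -G, -A*]`. -/
noncomputable def hamiltonian {n m : ℕ} (A : Matrix (Fin n) (Fin n) ℂ)
    (B : Matrix (Fin n) (Fin m) ℂ) (G : Matrix (Fin n) (Fin n) ℂ)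
    (Γ : Matrix (Fin m) (Fin m) ℂ) : Matrix (Fin n ⊕ Fin n) (Fin n ⊕ Fin n) ℂ :=
  Matrix.fromBlocks A (-(B * Γ⁻¹ * Bᴴ)) (-G) (-Aᴴ)

/-- `H` is a Hermitian solution of the strict Riccati inequality
`H A + A* H + G - H B Γ⁻¹ B* H < 0` (negative definiteness). -/
def IsSolution {n m : ℕ} (A : Matrix (Fin n) (Fin n) ℂ)
    (B : Matrix (Fin n) (Fin m) ℂ) (G : Matrix (Fin n) (Fin n) ℂ)
    (Γ : Matrix (Fin m) (Fin m) ℂ) (H : Matrix (Fin n) (Fin n) ℂ) : Prop :=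
  H.IsHermitian ∧ (-(H * A + Aᴴ * H + G - H * B * Γ⁻¹ * Bᴴ * H)).PosDef

end RiccatiInequality

/-! Write `D = B Γ⁻¹ Bᴴ`. The stable subspace of the Hamiltonian matrix is Lagrangian, spanned by
the columns of `[U; V]`. If `U` were invertible, `V U⁻¹` would solve the Riccati equation and be
stabilizing; but `U` may be singular when `D` is indefinite, and the inequality is strict. Both
defects are cured by one perturbation into the antistable subspace, spanned by a dual Lagrangian
basis `[U'; V']`: put `X = U + U' Y`, `W = V + V' Y` with `Y` small and Hermitian, and `H = W X⁻¹`.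

On the span of `[X; W]` the Riccati form is `Sᴴ Y + Y S` (`graph_riccati`), where `S` is the action
on the stable subspace. With `Y = t (Z₀ + t Z₁)`, where `Z₀` and `Z₁` solve the Lyapunov equations
with right sides `-Uᴴ U` and `-1`, it equals `-t (Uᴴ U + t)`, which is negative definite.
Controllability makes `(U, S)` observable, so `Z₀` is definite, and then `X` is invertible with `t
X⁻¹` bounded for small `t` (`exists_mul_norm_le_norm_mulVec`).

The closed loop is similar to `S + t X⁻¹ U' (Uᴴ U + t)`. Although `X⁻¹` may blow up, `U' Uᴴ = U U'ᴴ`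
(`symplectic_identity`) shows that the correction is `t L` with `L` bounded. In a basis where `S` is
strictly dissipative, this does not destroy stability. The antistabilizing solution comes from
replacing `A` by `-A` and `H` by `-H`. -/

namespace RiccatiInequality

/-! ### Dissipative bases -/

/-- An endomorphism whose eigenvalues have negative real part is strictly dissipative in a
suitable basis. -/
theorem exists_basis_dissipative (k : ℕ) : ∀ {V : Type*} [AddCommGroup V] [Module ℂ V]
    [FiniteDimensional ℂ V] (_ : Module.finrank ℂ V = k) (f : Module.End ℂ V)
    (_ : ∀ z, f.HasEigenvalue z → z.re < 0),
    ∃ b : Module.Basis (Fin k) ℂ V, ∃ ε > 0, ∀ v,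
      (∑ i, star (b.repr v i) * b.repr (f v) i).re ≤ -ε * ∑ i, ‖b.repr v i‖ ^ 2 := by
  induction k with
  | zero =>
    intro V _ _ _ hk f _
    exact ⟨Module.finBasisOfFinrankEq ℂ V hk, 1, one_pos, fun v => by simp⟩
  | succ k ih =>
    intro V _ _ _ hk f hf
    have : Nontrivial V := Module.nontrivial_of_finrank_pos (R := ℂ) (by omega)
    obtain ⟨μ, hμ⟩ := Module.End.exists_eigenvalue f
    have hμ0 := hf μ hμ
    -- A functional `φ` vanishing on this proper range is a left eigenvector, so its kernel is an
    -- invariant hyperplane for the induction.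
    have hlt : LinearMap.range (f - algebraMap ℂ _ μ) < ⊤ := by
      rw [lt_top_iff_ne_top, Ne, ← LinearMap.ker_eq_bot_iff_range_eq_top]
      have := hμ
      rw [Module.End.hasEigenvalue_iff, Module.End.eigenspace_def] at this
      exact this
    obtain ⟨φ, hφ, hle⟩ := Submodule.exists_le_ker_of_lt_top _ hlt
    have hinv : ∀ v, φ (f v) = μ * φ v := by
      intro v
      have := hle ⟨v, rfl⟩
      simp only [LinearMap.mem_ker, LinearMap.sub_apply, map_sub,
        Module.algebraMap_end_apply, map_smul, smul_eq_mul] at this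
      linear_combination this
    obtain ⟨w, hw⟩ : ∃ w, φ w = 1 := by
      obtain ⟨u, hu⟩ : ∃ u, φ u ≠ 0 := by
        by_contra! h
        exact hφ (LinearMap.ext h)
      exact ⟨(φ u)⁻¹ • u, by simp [hu]⟩
    have hK : ∀ x ∈ LinearMap.ker φ, f x ∈ LinearMap.ker φ := fun x hx => by
      rw [LinearMap.mem_ker] at hx ⊢
      rw [hinv, hx, mul_zero]
    have hfin : Module.finrank ℂ (LinearMap.ker φ) = k := by
      have := Module.Dual.finrank_ker_add_one_of_ne_zero hφ
      omega
    obtain ⟨b, ε₁, hε₁, hb⟩ := ih hfin (f.restrict hK) (fun z hz => by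
      obtain ⟨x, hx⟩ := hz.exists_hasEigenvector
      refine hf z (Module.End.hasEigenvalue_of_hasEigenvector (x := (x : V)) ?_)
      refine ⟨?_, fun h => hx.2 (Subtype.ext h)⟩
      rw [Module.End.mem_eigenspace_iff]
      exact congrArg Subtype.val hx.apply_eq_smul)
    let k0 : LinearMap.ker φ := ⟨f w - μ • w, by simp [hinv, hw]⟩
    set ε := min ε₁ (-μ.re) / 2 with hε
    have hεpos : 0 < ε := by
      have : 0 < min ε₁ (-μ.re) := lt_min hε₁ (by linarith)
      linarith
    have hε1 : 2 * ε ≤ ε₁ := by have := min_le_left ε₁ (-μ.re); linarith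
    have hε2 : 2 * ε ≤ -μ.re := by have := min_le_right ε₁ (-μ.re); linarith
    set κ := ∑ i, ‖b.repr k0 i‖ ^ 2 with hκ
    have hκ0 : 0 ≤ κ := Finset.sum_nonneg fun i _ => by positivity
    -- Shrinking the new basis vector to `s • w` scales its coupling to the hyperplane by `s`; this
    -- size lets Young's inequality absorb the cross term into half of each diagonal decay rate.
    set s : ℝ := 2 * ε / (κ + 1) with hs
    have hspos : 0 < s := by positivity
    have hsκ : s ^ 2 * κ ≤ 4 * ε ^ 2 := by
      rw [hs, div_pow, div_mul_eq_mul_div, div_le_iff₀ (by positivity)]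
      nlinarith [mul_nonneg (sq_nonneg ε) hκ0, mul_nonneg (sq_nonneg ε) (sq_nonneg κ)]
    have hsC : (s : ℂ) ≠ 0 := by exact_mod_cast hspos.ne'
    let b' : Module.Basis (Fin (k + 1)) ℂ V := Module.Basis.mkFinCons ((s : ℂ) • w) b
      (fun c x hx h => by
        have := congrArg φ h
        rw [LinearMap.mem_ker] at hx
        simpa [hx, hw, hsC] using this)
      (fun z => ⟨-(φ z / s), by simp [hw, hsC]⟩)
    have hrepr : ∀ (a : ℂ) (x : LinearMap.ker φ) (i : Fin (k + 1)),
        b'.repr (a • (s : ℂ) • w + x) i = (Fin.cons a (fun j => b.repr x j) : Fin (k + 1) → ℂ) i := by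
      intro a x i
      have : a • (s : ℂ) • w + (x : V)
          = ∑ i, (Fin.cons a (fun j => b.repr x j) : Fin (k + 1) → ℂ) i • b' i := by
        rw [Fin.sum_univ_succ]
        simp only [b', Fin.cons_zero, Fin.cons_succ, Module.Basis.coe_mkFinCons,
          Function.comp_apply]
        congr 1
        conv_lhs => rw [← b.sum_repr x]
        simp only [Submodule.coe_sum, Submodule.coe_smul]
      rw [this, Module.Basis.repr_sum_self]
    refine ⟨b', ε, hεpos, fun v => ?_⟩
    obtain ⟨a, x, rfl⟩ : ∃ (a : ℂ) (x : LinearMap.ker φ), v = a • (s : ℂ) • w + x :=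
      ⟨φ v / s, ⟨v - φ v • w, by simp [hw]⟩, by
        rw [smul_smul, div_mul_cancel₀ _ hsC]
        simp⟩
    have hfv : f (a • (s : ℂ) • w + x) = (μ * a) • (s : ℂ) • w
        + ((f.restrict hK x + (a * s) • k0 : LinearMap.ker φ) : V) := by
      simp only [map_add, map_smul, Submodule.coe_add, Submodule.coe_smul, k0,
        LinearMap.coe_restrict_apply]
      module
    rw [hfv]
    simp only [hrepr]
    simp only [Fin.sum_univ_succ, Fin.cons_zero, Fin.cons_succ, map_add, map_smul,
      Finsupp.add_apply, Finsupp.smul_apply, smul_eq_mul, mul_add, Finset.sum_add_distrib,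
      Complex.add_re]
    have h1 : (star a * (μ * a)).re = μ.re * ‖a‖ ^ 2 := by
      have : star a * (μ * a) = μ * ((‖a‖ ^ 2 : ℝ) : ℂ) := by
        have := Complex.conj_mul' a
        simp only [Complex.star_def]
        push_cast
        linear_combination μ * this
      rw [this, Complex.re_mul_ofReal]
    have h2 : (∑ i, star (b.repr x i) * (a * s * b.repr k0 i)).re
        ≤ ε * ∑ i, ‖b.repr x i‖ ^ 2 + ε * ‖a‖ ^ 2 := by
      calc (∑ i, star (b.repr x i) * (a * s * b.repr k0 i)).re
          ≤ ‖∑ i, star (b.repr x i) * (a * s * b.repr k0 i)‖ := Complex.re_le_norm _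
        _ ≤ ∑ i, ‖star (b.repr x i) * (a * s * b.repr k0 i)‖ := norm_sum_le _ _
        _ ≤ ∑ i, (ε * ‖b.repr x i‖ ^ 2 + s ^ 2 / (4 * ε) * ‖a‖ ^ 2 * ‖b.repr k0 i‖ ^ 2) := by
          refine Finset.sum_le_sum fun i _ => ?_
          rw [norm_mul, norm_star, norm_mul, norm_mul, Complex.norm_real,
            Real.norm_of_nonneg hspos.le]
          set X := ‖b.repr x i‖
          set Y := ‖a‖ * s * ‖b.repr k0 i‖
          have : s ^ 2 / (4 * ε) * ‖a‖ ^ 2 * ‖b.repr k0 i‖ ^ 2 = Y ^ 2 / (4 * ε) := by ring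
          rw [this]
          have h4 : ε * X ^ 2 + Y ^ 2 / (4 * ε) - X * Y = (2 * ε * X - Y) ^ 2 / (4 * ε) := by
            field_simp
            ring
          have : 0 ≤ (2 * ε * X - Y) ^ 2 / (4 * ε) := by positivity
          linarith
        _ = ε * ∑ i, ‖b.repr x i‖ ^ 2 + s ^ 2 * κ / (4 * ε) * ‖a‖ ^ 2 := by
          rw [Finset.sum_add_distrib, ← Finset.mul_sum, ← Finset.mul_sum]
          ring
        _ ≤ _ := by
          gcongr
          rw [div_le_iff₀ (by positivity)]
          linarith
    have h3 := hb x
    have hX : 0 ≤ ∑ i, ‖b.repr x i‖ ^ 2 := Finset.sum_nonneg fun i _ => by positivity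
    rw [h1]
    nlinarith [sq_nonneg ‖a‖, mul_le_mul_of_nonneg_right hε1 hX,
      mul_le_mul_of_nonneg_right hε2 (sq_nonneg ‖a‖)]

/-- The numerical range of `S` lies in an open left half plane bounded away from the imaginary
axis. -/
def IsDissipative {k : ℕ} (S : Matrix (Fin k) (Fin k) ℂ) : Prop :=
  ∃ ε > 0, ∀ x : Fin k → ℂ, (star x ⬝ᵥ S *ᵥ x).re ≤ -ε * ∑ i, ‖x i‖ ^ 2

/-! ### Lyapunov equations with a dissipative coefficient -/

section Lyapunov

variable {k : ℕ} {S : Matrix (Fin k) (Fin k) ℂ}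

theorem sum_norm_sq_pos {x : Fin k → ℂ} (hx : x ≠ 0) : 0 < ∑ i, ‖x i‖ ^ 2 := by
  obtain ⟨i, hi⟩ := Function.ne_iff.mp hx
  exact Finset.sum_pos' (fun _ _ => by positivity)
    ⟨i, Finset.mem_univ _, by have := norm_pos_iff.mpr hi; positivity⟩

theorem IsDissipative.re_neg (hS : IsDissipative S) {x : Fin k → ℂ} (hx : x ≠ 0) :
    (star x ⬝ᵥ S *ᵥ x).re < 0 := by
  obtain ⟨ε, hε, h⟩ := hS
  nlinarith [h x, mul_pos hε (sum_norm_sq_pos hx)]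

theorem re_lyapunov_eigenvector {M : Matrix (Fin k) (Fin k) ℂ} (hM : M.IsHermitian)
    {x : Fin k → ℂ} {t : ℝ} (hx : M *ᵥ x = t • x) :
    (star x ⬝ᵥ (Sᴴ * M + M * S) *ᵥ x).re = 2 * t * (star x ⬝ᵥ S *ᵥ x).re := by
  have h1 : star x ⬝ᵥ M *ᵥ (S *ᵥ x) = t * (star x ⬝ᵥ S *ᵥ x) := by
    rw [Matrix.dotProduct_mulVec, ← hM.eq, ← Matrix.star_mulVec, hx]
    simp [smul_dotProduct]
  have h2 : star x ⬝ᵥ Sᴴ *ᵥ (M *ᵥ x) = t * star (star x ⬝ᵥ S *ᵥ x) := by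
    rw [hx, Matrix.mulVec_smul, dotProduct_smul, Matrix.dotProduct_mulVec, ← Matrix.star_mulVec,
      Matrix.star_dotProduct]
    simp
  rw [Matrix.add_mulVec, dotProduct_add, ← Matrix.mulVec_mulVec, ← Matrix.mulVec_mulVec, h1, h2]
  simp
  ring

theorem IsDissipative.eq_zero_of_isHermitian (hS : IsDissipative S)
    {M : Matrix (Fin k) (Fin k) ℂ} (hM : M.IsHermitian) (h : Sᴴ * M + M * S = 0) : M = 0 := by
  by_contra hne
  obtain ⟨v, t, ht, hv, hvt⟩ := hM.exists_eigenvector_of_ne_zero hne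
  have h1 := re_lyapunov_eigenvector (S := S) hM hvt
  rw [h] at h1
  simp only [Matrix.zero_mulVec, dotProduct_zero, Complex.zero_re] at h1
  have := hS.re_neg hv
  rcases mul_eq_zero.mp h1.symm with h2 | h2
  · exact ht (by linarith)
  · exact this.ne h2

/-- The equation is invariant under conjugate transposition, so the Hermitian and skew-Hermitian
parts of `M` solve it separately. -/
theorem IsDissipative.eq_zero (hS : IsDissipative S)
    {M : Matrix (Fin k) (Fin k) ℂ} (h : Sᴴ * M + M * S = 0) : M = 0 := by
  have h' : Sᴴ * Mᴴ + Mᴴ * S = 0 := by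
    have := congrArg Matrix.conjTranspose h
    simpa [Matrix.conjTranspose_add, Matrix.conjTranspose_mul, add_comm] using this
  have h1 : M + Mᴴ = 0 := hS.eq_zero_of_isHermitian (Matrix.isHermitian_add_transpose_self M) (by
    rw [mul_add, add_mul, add_add_add_comm, h, h', add_zero])
  have h2 : Complex.I • (M - Mᴴ) = 0 := hS.eq_zero_of_isHermitian
    (by simp [Matrix.IsHermitian, Matrix.conjTranspose_smul, Matrix.conjTranspose_sub,
      ← smul_neg]) (by
    rw [Matrix.mul_smul, Matrix.smul_mul, ← smul_add, mul_sub, sub_mul, sub_add_sub_comm, h, h',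
      sub_zero, smul_zero])
  have h3 : M - Mᴴ = 0 := (smul_eq_zero.mp h2).resolve_left Complex.I_ne_zero
  have h4 : (2 : ℂ) • M = 0 := by
    rw [two_smul]
    calc M + M = (M + Mᴴ) + (M - Mᴴ) := by abel
      _ = 0 := by rw [h1, h3, add_zero]
  exact (smul_eq_zero.mp h4).resolve_left two_ne_zero

/-- The Lyapunov equation of a dissipative matrix is solvable. -/
theorem IsDissipative.exists_lyapunov (hS : IsDissipative S)
    {Q : Matrix (Fin k) (Fin k) ℂ} (hQ : Q.IsHermitian) :
    ∃ Z : Matrix (Fin k) (Fin k) ℂ, Z.IsHermitian ∧ Sᴴ * Z + Z * S = Q := by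
  let L : Matrix (Fin k) (Fin k) ℂ →ₗ[ℂ] Matrix (Fin k) (Fin k) ℂ :=
    LinearMap.mulLeft ℂ Sᴴ + LinearMap.mulRight ℂ S
  have hL : ∀ Z, L Z = Sᴴ * Z + Z * S := fun Z => rfl
  have hinj : Function.Injective L := (injective_iff_map_eq_zero L).mpr fun Z hZ =>
    hS.eq_zero (hZ ▸ (hL Z).symm)
  obtain ⟨Z, hZ⟩ := LinearMap.injective_iff_surjective.mp hinj Q
  refine ⟨Z, ?_, hZ⟩
  apply hinj
  rw [hZ, hL, ← hQ.eq, ← hZ, hL]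
  simp [Matrix.conjTranspose_add, Matrix.conjTranspose_mul, add_comm]

/-- Testing the equation on an eigenvector of `Z` gives eigenvalue times a negative number on the
left and a nonpositive number on the right. -/
theorem IsDissipative.posSemidef_of_lyapunov (hS : IsDissipative S)
    {Z Q : Matrix (Fin k) (Fin k) ℂ} (hZ : Z.IsHermitian) (hQ : Q.PosSemidef)
    (h : Sᴴ * Z + Z * S = -Q) : Z.PosSemidef := by
  rw [hZ.posSemidef_iff_eigenvalues_nonneg]
  intro j
  have hv : (hZ.eigenvectorBasis j).ofLp ≠ 0 := fun h0 =>
    hZ.eigenvectorBasis.toBasis.ne_zero j (by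
      rw [OrthonormalBasis.coe_toBasis]
      exact (WithLp.ofLp_eq_zero 2).mp h0)
  have h1 := re_lyapunov_eigenvector (S := S) hZ (hZ.mulVec_eigenvectorBasis j)
  rw [h, Matrix.neg_mulVec, dotProduct_neg, Complex.neg_re] at h1
  have h2 := (Complex.le_def.mp (hQ.dotProduct_mulVec_nonneg (hZ.eigenvectorBasis j).ofLp)).1
  have h3 := hS.re_neg hv
  simp only [Complex.zero_re] at h2
  change 0 ≤ hZ.eigenvalues j
  by_contra! hneg
  nlinarith [mul_pos_of_neg_of_neg hneg h3]

end Lyapunov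

/-! ### Stable and antistable spectral subspaces -/

section Splitting

variable {V : Type*} [AddCommGroup V] [Module ℂ V] 

/-- The sum of the generalized eigenspaces of `f` for the eigenvalues in `s`. -/
noncomputable def spectralSubspace (f : Module.End ℂ V) (s : Set ℂ) : Submodule ℂ V :=
  ⨆ z ∈ s, f.maxGenEigenspace z

theorem mapsTo_spectralSubspace (f : Module.End ℂ V) (s : Set ℂ) :
    ∀ x ∈ spectralSubspace f s, f x ∈ spectralSubspace f s := by
  change spectralSubspace f s ≤ (spectralSubspace f s).comap f
  refine iSup₂_le fun z hz x hx => ?_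
  exact (le_iSup₂_of_le z hz le_rfl : f.maxGenEigenspace z ≤ spectralSubspace f s)
    (Module.End.mapsTo_maxGenEigenspace_of_comm (Commute.refl f) z hx)

theorem mem_of_hasEigenvalue_restrict_spectralSubspace (f : Module.End ℂ V) (s : Set ℂ) (z : ℂ)
    (hz : Module.End.HasEigenvalue (f.restrict (mapsTo_spectralSubspace f s)) z) : z ∈ s := by
  by_contra hzs
  obtain ⟨x, hx⟩ := hz.exists_hasEigenvector
  have h1 : (x : V) ∈ f.maxGenEigenspace z := by
    refine (f.genEigenspace z).monotone (le_top : (1 : ℕ∞) ≤ ⊤) ?_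
    change (x : V) ∈ f.eigenspace z
    rw [Module.End.mem_eigenspace_iff]
    exact congrArg Subtype.val hx.apply_eq_smul
  have h2 := f.independent_maxGenEigenspace.disjoint_biSup hzs
  exact hx.2 (Subtype.ext (Submodule.disjoint_def.mp h2 _ h1 x.2))

theorem isCompl_spectralSubspace [FiniteDimensional ℂ V] (f : Module.End ℂ V) (hf : ∀ z, f.HasEigenvalue z → z.re ≠ 0) :
    IsCompl (spectralSubspace f {z | z.re < 0}) (spectralSubspace f {z | 0 < z.re}) := by
  constructor
  · refine f.independent_maxGenEigenspace.disjoint_biSup_biSup ?_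
    rw [Set.disjoint_left]
    intro z hz hz'
    exact lt_asymm (a := z.re) hz hz'
  · rw [codisjoint_iff, eq_top_iff, ← f.iSup_maxGenEigenspace_eq_top]
    refine iSup_le fun z => ?_
    rcases lt_trichotomy z.re 0 with h | h | h
    · exact le_sup_of_le_left (le_iSup₂_of_le z h le_rfl)
    · have : f.maxGenEigenspace z = ⊥ := by
        by_contra hne
        exact hf z (Module.End.HasUnifEigenvalue.lt (k := ⊤) one_pos hne) h
      rw [this]
      exact bot_le
    · exact le_sup_of_le_right (le_iSup₂_of_le z h le_rfl)

end Splitting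

/-! ### Matrix form of the spectral splitting -/

section Matrix

variable {ι : Type*} [Fintype ι]

theorem exists_restriction_matrix (R : Matrix ι ι ℂ) (X : Submodule ℂ (ι → ℂ))
    (hX : ∀ x ∈ X, R.mulVecLin x ∈ X) {k : ℕ} (b : Module.Basis (Fin k) ℂ X) :
    ∃ (W : Matrix ι (Fin k) ℂ) (S : Matrix (Fin k) (Fin k) ℂ),
      R * W = W * S ∧ (∀ x, W *ᵥ x = b.equivFun.symm x) ∧
      (∀ v, S *ᵥ b.equivFun v = b.equivFun (R.mulVecLin.restrict hX v)) := by
  have hW : ∀ x, (Matrix.of fun i j => (b j : ι → ℂ) i) *ᵥ x = b.equivFun.symm x := by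
    intro x
    ext i
    simp [Matrix.mulVec, dotProduct, Module.Basis.equivFun_symm_apply, mul_comm]
  have hS : ∀ v, LinearMap.toMatrix b b (R.mulVecLin.restrict hX) *ᵥ b.equivFun v
      = b.equivFun (R.mulVecLin.restrict hX v) := fun v =>
    LinearMap.toMatrix_mulVec_repr b b _ v
  refine ⟨Matrix.of fun i j => (b j : ι → ℂ) i, LinearMap.toMatrix b b (R.mulVecLin.restrict hX),
    ?_, hW, hS⟩
  refine Matrix.mulVec_injective (funext fun x => ?_)
  rw [← Matrix.mulVec_mulVec, ← Matrix.mulVec_mulVec, hW, hW]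
  obtain ⟨v, rfl⟩ := b.equivFun.surjective x
  rw [hS]
  simp

theorem exists_dissipative_splitting [DecidableEq ι] (R : Matrix ι ι ℂ) (hR : ∀ z ∈ spectrum ℂ R, z.re ≠ 0) :
    ∃ (k l : ℕ) (W₁ : Matrix ι (Fin k) ℂ) (W₂ : Matrix ι (Fin l) ℂ)
      (S₁ : Matrix (Fin k) (Fin k) ℂ) (S₂ : Matrix (Fin l) (Fin l) ℂ),
      R * W₁ = W₁ * S₁ ∧ R * W₂ = W₂ * S₂ ∧ IsDissipative S₁ ∧ IsDissipative (-S₂) ∧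
      (∀ x y, W₁ *ᵥ x + W₂ *ᵥ y = 0 → x = 0 ∧ y = 0) ∧ k + l = Fintype.card ι := by
  set f : Module.End ℂ (ι → ℂ) := R.mulVecLin with hf
  have hspec : ∀ z, f.HasEigenvalue z → z.re ≠ 0 := fun z hz => hR z (by
    rw [← Matrix.spectrum_toLin']
    exact hz.mem_spectrum)
  have hc := isCompl_spectralSubspace f hspec
  have hX₁ := mapsTo_spectralSubspace f {z | z.re < 0}
  have hX₂ := mapsTo_spectralSubspace f {z | 0 < z.re}
  have he₁ := mem_of_hasEigenvalue_restrict_spectralSubspace f {z | z.re < 0}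
  have he₂ := mem_of_hasEigenvalue_restrict_spectralSubspace f {z | 0 < z.re}
  set X₁ := spectralSubspace f {z | z.re < 0}
  set X₂ := spectralSubspace f {z | 0 < z.re}
  obtain ⟨b₁, ε₁, hε₁, hb₁⟩ := exists_basis_dissipative _ rfl (f.restrict hX₁) he₁
  obtain ⟨b₂, ε₂, hε₂, hb₂⟩ := exists_basis_dissipative _ rfl (-f.restrict hX₂) (fun z hz => by
    have : Module.End.HasEigenvalue (f.restrict hX₂) (-z) := by
      obtain ⟨x, hx⟩ := hz.exists_hasEigenvector
      refine Module.End.hasEigenvalue_of_hasEigenvector (x := x) ⟨?_, hx.2⟩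
      rw [Module.End.mem_eigenspace_iff, neg_smul, ← hx.apply_eq_smul]
      simp
    have := he₂ _ this
    simpa using this)
  obtain ⟨W₁, S₁, hRW₁, hW₁, hS₁⟩ := exists_restriction_matrix R X₁ hX₁ b₁
  obtain ⟨W₂, S₂, hRW₂, hW₂, hS₂⟩ := exists_restriction_matrix R X₂ hX₂ b₂
  refine ⟨_, _, W₁, W₂, S₁, S₂, hRW₁, hRW₂, ⟨ε₁, hε₁, fun x => ?_⟩, ⟨ε₂, hε₂, fun x => ?_⟩,
    fun x y hxy => ?_, ?_⟩
  · obtain ⟨v, rfl⟩ := b₁.equivFun.surjective x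
    rw [hS₁]
    exact hb₁ v
  · obtain ⟨v, rfl⟩ := b₂.equivFun.surjective x
    rw [Matrix.neg_mulVec, hS₂, ← map_neg]
    exact hb₂ v
  · rw [hW₁, hW₂] at hxy
    have h1 : ((b₁.equivFun.symm x : X₁) : ι → ℂ) = 0 := by
      refine Submodule.disjoint_def.mp hc.disjoint _ (Subtype.prop _) ?_
      rw [eq_neg_of_add_eq_zero_left hxy]
      exact X₂.neg_mem (Subtype.prop _)
    have h2 : ((b₂.equivFun.symm y : X₂) : ι → ℂ) = 0 := by
      rwa [h1, zero_add] at hxy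
    exact ⟨b₁.equivFun.symm.map_eq_zero_iff.mp (Subtype.ext h1),
      b₂.equivFun.symm.map_eq_zero_iff.mp (Subtype.ext h2)⟩
  · rw [Submodule.finrank_add_eq_of_isCompl hc, Module.finrank_pi]

end Matrix

/-! ### Symplectic normal form of the Hamiltonian matrix -/

/-- The symplectic splitting of a Hamiltonian matrix without imaginary eigenvalues, written in
blocks: the columns of `[U; V]` span the stable subspace, those of `[U'; V']` the antistable one. -/
theorem exists_symplectic_splitting {n : ℕ} {A D G : Matrix (Fin n) (Fin n) ℂ}
    (hD : D.IsHermitian) (hG : G.IsHermitian)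
    (hR : ∀ z ∈ spectrum ℂ (Matrix.fromBlocks A (-D) (-G) (-Aᴴ)), z.re ≠ 0) :
    ∃ U V U' V' S : Matrix (Fin n) (Fin n) ℂ, IsDissipative S ∧
      A * U - D * V = U * S ∧ -(G * U) - Aᴴ * V = V * S ∧
      A * U' - D * V' = -(U' * Sᴴ) ∧ -(G * U') - Aᴴ * V' = -(V' * Sᴴ) ∧
      Uᴴ * V = Vᴴ * U ∧ U'ᴴ * V' = V'ᴴ * U' ∧ Uᴴ * V' - Vᴴ * U' = 1 := by
  set R := Matrix.fromBlocks A (-D) (-G) (-Aᴴ) with hRdef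
  set J : Matrix (Fin n ⊕ Fin n) (Fin n ⊕ Fin n) ℂ := Matrix.fromBlocks 0 1 (-1) 0 with hJ
  have hRJ : Rᴴ * J + J * R = 0 := by
    rw [hRdef, hJ, Matrix.fromBlocks_conjTranspose, Matrix.fromBlocks_multiply,
      Matrix.fromBlocks_multiply, Matrix.fromBlocks_add]
    simp [hD.eq, hG.eq]
  have hJJ : J * J = -1 := by
    rw [hJ, Matrix.fromBlocks_multiply, ← Matrix.fromBlocks_one, Matrix.fromBlocks_neg]
    simp
  have hJinj : ∀ x, J *ᵥ x = 0 → x = 0 := fun x hx => by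
    have : (J * J) *ᵥ x = 0 := by rw [← Matrix.mulVec_mulVec, hx, Matrix.mulVec_zero]
    simpa [hJJ, Matrix.neg_mulVec] using this
  obtain ⟨k, l, W₁, W₂, S₁, S₂, hRW₁, hRW₂, hS₁, hS₂, hinj, hkl⟩ :=
    exists_dissipative_splitting R hR
  have hkl2 : k + l = 2 * n := by rw [hkl]; simp; ring
  -- Since `R` is skew for the form `J`, the Gram matrix of two invariant subspaces solves a
  -- homogeneous Sylvester equation. For a subspace paired with itself, dissipativity makes it
  -- vanish.
  have key : ∀ {p q : ℕ} (W : Matrix (Fin n ⊕ Fin n) (Fin p) ℂ)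
      (W' : Matrix (Fin n ⊕ Fin n) (Fin q) ℂ) (S : Matrix (Fin p) (Fin p) ℂ)
      (S' : Matrix (Fin q) (Fin q) ℂ), R * W = W * S → R * W' = W' * S' →
      Sᴴ * (Wᴴ * J * W') + (Wᴴ * J * W') * S' = 0 := by
    intro p q W W' S S' h h'
    have h2 : Sᴴ * Wᴴ = Wᴴ * Rᴴ := by
      rw [← Matrix.conjTranspose_mul, ← Matrix.conjTranspose_mul, h]
    calc Sᴴ * (Wᴴ * J * W') + (Wᴴ * J * W') * S'
        = (Sᴴ * Wᴴ) * J * W' + Wᴴ * J * (W' * S') := by simp only [Matrix.mul_assoc]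
      _ = Wᴴ * (Rᴴ * J + J * R) * W' := by
        rw [h2, ← h', Matrix.mul_add, Matrix.add_mul]
        simp only [Matrix.mul_assoc]
      _ = 0 := by rw [hRJ, Matrix.mul_zero, Matrix.zero_mul]
  have hiso₁ : W₁ᴴ * J * W₁ = 0 := hS₁.eq_zero (key _ _ _ _ hRW₁ hRW₁)
  have hiso₂ : W₂ᴴ * J * W₂ = 0 := hS₂.eq_zero (by
    rw [Matrix.conjTranspose_neg, Matrix.neg_mul, Matrix.mul_neg, ← neg_add,
      key _ _ _ _ hRW₂ hRW₂, neg_zero])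
  -- Isotropic subspaces have dimension at most `n`; as the two dimensions add up to `2 * n`, both
  -- equal `n`.
  have hdim : ∀ {p : ℕ} (W : Matrix (Fin n ⊕ Fin n) (Fin p) ℂ), (∀ x, W *ᵥ x = 0 → x = 0) →
      Wᴴ * J * W = 0 → p ≤ n := by
    intro p W hW h
    have h1 := Matrix.rank_add_rank_le_card_of_mul_eq_zero (A := Wᴴ) (B := J * W)
      (by rw [← Matrix.mul_assoc, h])
    have h2 : ∀ W' : Matrix (Fin n ⊕ Fin n) (Fin p) ℂ, (∀ x, W' *ᵥ x = 0 → x = 0) →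
        W'.rank = p := by
      intro W' h'
      rw [Matrix.rank, LinearMap.finrank_range_of_inj
        ((injective_iff_map_eq_zero W'.mulVecLin).mpr h')]
      simp
    rw [Matrix.rank_conjTranspose, h2 W hW, h2 (J * W) (fun x hx => hW x (hJinj _ (by
      rwa [Matrix.mulVec_mulVec])))] at h1
    simp at h1
    omega
  have hk := hdim W₁ (fun x hx => (hinj x 0 (by simp [hx])).1) hiso₁
  have hl := hdim W₂ (fun x hx => (hinj 0 x (by simp [hx])).2) hiso₂
  obtain rfl : k = n := by omega
  obtain rfl : l = k := by omega
  clear hdim hkl hkl2 hk hl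
  set N := W₁ᴴ * J * W₂ with hN
  have hT : IsUnit (Matrix.fromCols W₁ W₂) := by
    rw [← Matrix.mulVec_injective_iff_isUnit]
    refine (injective_iff_map_eq_zero (Matrix.mulVecLin _)).mpr fun x hx => ?_
    rw [Matrix.mulVecLin_apply, Matrix.fromCols_mulVec] at hx
    obtain ⟨h1, h2⟩ := hinj _ _ hx
    ext (i | i)
    · exact congrFun h1 i
    · exact congrFun h2 i
  -- If `N x = 0`, then `W₂ x` is `J`-orthogonal to both subspaces, hence zero. Passing to `W₂ N⁻¹`
  -- makes the bases dual and turns `S₂` into `-S₁ᴴ`.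
  have hNunit : IsUnit N := by
    rw [← Matrix.mulVec_injective_iff_isUnit]
    refine (injective_iff_map_eq_zero (Matrix.mulVecLin _)).mpr fun x hx => ?_
    rw [Matrix.mulVecLin_apply] at hx
    have h1 : (Matrix.fromCols W₁ W₂)ᴴ *ᵥ (J *ᵥ (W₂ *ᵥ x)) = 0 := by
      rw [Matrix.conjTranspose_fromCols_eq_fromRows_conjTranspose, Matrix.fromRows_mulVec,
        Matrix.mulVec_mulVec, Matrix.mulVec_mulVec, Matrix.mulVec_mulVec, Matrix.mulVec_mulVec,
        ← hN, hx, hiso₂, Matrix.zero_mulVec]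
      ext (i | i) <;> rfl
    have h2 := (injective_iff_map_eq_zero (Matrix.mulVecLin _)).mp
      (Matrix.mulVec_injective_iff_isUnit.mpr hT.star) _ h1
    exact (hinj 0 x (by rw [Matrix.mulVec_zero, zero_add, hJinj _ h2])).2
  have hNdet := (Matrix.isUnit_iff_isUnit_det _).mp hNunit
  have hNS : N * S₂ * N⁻¹ = -S₁ᴴ := by
    have h1 : N * S₂ = -(S₁ᴴ * N) :=
      eq_neg_of_add_eq_zero_right (key _ _ _ _ hRW₁ hRW₂)
    rw [h1, Matrix.neg_mul, Matrix.mul_nonsing_inv_cancel_right _ _ hNdet]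
  have hRW₂' : R * (W₂ * N⁻¹) = -(W₂ * N⁻¹ * S₁ᴴ) := by
    rw [← Matrix.mul_neg, ← hNS, ← Matrix.mul_assoc, hRW₂]
    simp only [Matrix.mul_assoc, Matrix.nonsing_inv_mul_cancel_left _ _ hNdet]
  have hiso₂' : (W₂ * N⁻¹)ᴴ * J * (W₂ * N⁻¹) = 0 := by
    calc (W₂ * N⁻¹)ᴴ * J * (W₂ * N⁻¹) = N⁻¹ᴴ * (W₂ᴴ * J * W₂) * N⁻¹ := by
          rw [Matrix.conjTranspose_mul]; simp only [Matrix.mul_assoc]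
      _ = 0 := by rw [hiso₂, Matrix.mul_zero, Matrix.zero_mul]
  have hpair : W₁ᴴ * J * (W₂ * N⁻¹) = 1 := by
    rw [← Matrix.mul_assoc, ← hN, Matrix.mul_nonsing_inv _ hNdet]
  generalize W₂ * N⁻¹ = W' at hRW₂' hiso₂' hpair
  have hform : ∀ U V U' V' : Matrix (Fin l) (Fin l) ℂ,
      (Matrix.fromRows U V)ᴴ * J * Matrix.fromRows U' V' = Uᴴ * V' - Vᴴ * U' := by
    intro U V U' V'
    rw [Matrix.mul_assoc, hJ, Matrix.fromBlocks_mul_fromRows,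
      Matrix.conjTranspose_fromRows_eq_fromCols_conjTranspose, Matrix.fromCols_mul_fromRows]
    simp [sub_eq_add_neg]
  obtain ⟨U, V, rfl⟩ : ∃ U V, W₁ = Matrix.fromRows U V := ⟨_, _, (Matrix.fromRows_toRows W₁).symm⟩
  obtain ⟨U', V', rfl⟩ : ∃ U V, W' = Matrix.fromRows U V := ⟨_, _, (Matrix.fromRows_toRows W').symm⟩
  rw [hform] at hiso₁ hiso₂' hpair
  rw [hRdef, Matrix.fromBlocks_mul_fromRows, Matrix.fromRows_mul] at hRW₁ hRW₂'
  rw [Matrix.fromRows_neg] at hRW₂'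
  obtain ⟨h1, h2⟩ := (Matrix.fromRows_ext_iff _ _ _ _).mp hRW₁
  obtain ⟨h3, h4⟩ := (Matrix.fromRows_ext_iff _ _ _ _).mp hRW₂'
  simp only [Matrix.neg_mul, ← sub_eq_add_neg] at h1 h2 h3 h4
  exact ⟨U, V, U', V', S₁, hS₁, h1, h2, h3, h4, sub_eq_zero.mp hiso₁, sub_eq_zero.mp hiso₂', hpair⟩

/-! ### Perturbed graphs over the stable subspace -/

section

variable {n : ℕ} {A D G U V U' V' S Y Z Z₀ Z₁ : Matrix (Fin n) (Fin n) ℂ}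

/-- The kernel of `Z` is `S`-invariant and contained in the kernel of `U`, so observability
annihilates it. -/
theorem eq_zero_of_observable_of_lyapunov (hobs : ∀ c, (∀ k : ℕ, U *ᵥ (S ^ k *ᵥ c) = 0) → c = 0)
    (hZ : Z.PosSemidef) (h : Sᴴ * Z + Z * S = -(Uᴴ * U)) {c : Fin n → ℂ}
    (hc : star c ⬝ᵥ Z *ᵥ c = 0) : c = 0 := by
  have hstep : ∀ c, Z *ᵥ c = 0 → U *ᵥ c = 0 ∧ Z *ᵥ (S *ᵥ c) = 0 := by
    intro c hc
    have h1 : Z *ᵥ (S *ᵥ c) = -(Uᴴ *ᵥ (U *ᵥ c)) := by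
      have := congrArg (· *ᵥ c) h
      simpa [Matrix.add_mulVec, ← Matrix.mulVec_mulVec, hc, Matrix.neg_mulVec] using this
    have h2 : star (U *ᵥ c) ⬝ᵥ (U *ᵥ c) = 0 := by
      have h3 : star c ⬝ᵥ Z *ᵥ (S *ᵥ c) = 0 := by
        rw [Matrix.dotProduct_mulVec, ← hZ.isHermitian.eq, ← Matrix.star_mulVec, hc]
        simp
      rw [h1, dotProduct_neg, neg_eq_zero, Matrix.dotProduct_mulVec, ← Matrix.star_mulVec] at h3
      exact h3
    have h3 : U *ᵥ c = 0 := dotProduct_star_self_eq_zero.mp h2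
    exact ⟨h3, by rw [h1, h3, Matrix.mulVec_zero, neg_zero]⟩
  have hk : ∀ k : ℕ, Z *ᵥ (S ^ k *ᵥ c) = 0 := by
    intro k
    induction k with
    | zero => simpa using hZ.dotProduct_mulVec_zero_iff _ |>.mp hc
    | succ k ih =>
      rw [pow_succ', ← Matrix.mulVec_mulVec]
      exact (hstep _ ih).2
  exact hobs c fun k => (hstep _ (hk k)).1

/-- The graph of `t • Z` over a Lagrangian subspace approaches a vertical direction at most
linearly in `t` when `Z` is definite. -/
theorem exists_mul_norm_le_norm_mulVec (hUV : Uᴴ * V = Vᴴ * U) (hpair : Uᴴ * V' - Vᴴ * U' = 1)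
    (hZ₀ : ∀ c, star c ⬝ᵥ Z₀ *ᵥ c = 0 → c = 0) :
    ∃ C > 0, ∃ δ > 0, ∀ t : ℝ, 0 < t → t < δ → ∀ c,
      t * ‖c‖ ≤ C * ‖(U + U' * (t • (Z₀ + t • Z₁))) *ᵥ c‖ := by
  -- Failure for every `C = k + 1` and `δ = 1 / (k + 1)` yields unit vectors `d k` and `t k → 0`
  -- with `X d = t e` and `e → 0`. A limit point `a` satisfies `U a = 0`.
  by_contra! hcon
  have hseq : ∀ k : ℕ, ∃ (t : ℝ) (d : Fin n → ℂ), 0 < t ∧ t < 1 / (k + 1 : ℝ) ∧ ‖d‖ = 1 ∧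
      ‖t⁻¹ • (U + U' * (t • (Z₀ + t • Z₁))) *ᵥ d‖ ≤ 1 / (k + 1 : ℝ) := by
    intro k
    have hk : (0 : ℝ) < k + 1 := by positivity
    obtain ⟨t, ht0, ht, c, hc⟩ := hcon (k + 1) hk (1 / (k + 1 : ℝ)) (by positivity)
    have hc0 : 0 < ‖c‖ := by
      by_contra! h
      have : ‖c‖ = 0 := le_antisymm h (norm_nonneg _)
      rw [this, mul_zero] at hc
      exact absurd hc (not_lt.mpr (by positivity))
    refine ⟨t, ‖c‖⁻¹ • c, ht0, ht, by rw [norm_smul, norm_inv, norm_norm, inv_mul_cancel₀ hc0.ne'],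
      ?_⟩
    rw [Matrix.mulVec_smul, norm_smul, norm_smul, norm_inv, norm_inv, norm_norm,
      Real.norm_of_nonneg ht0.le, ← mul_assoc, ← mul_inv, inv_mul_le_iff₀ (by positivity),
      mul_one_div, le_div_iff₀ hk, mul_comm]
    exact hc.le
  choose t d ht0 ht hd he using hseq
  obtain ⟨a, ha, φ, hφ, hlim⟩ := (isCompact_sphere (0 : Fin n → ℂ) 1).tendsto_subseq
    (x := d) (fun k => by simp [hd])
  have hinv : Filter.Tendsto (fun k => 1 / ((φ k : ℕ) + 1 : ℝ)) Filter.atTop (nhds 0) :=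
    tendsto_one_div_add_atTop_nhds_zero_nat.comp hφ.tendsto_atTop
  have htlim : Filter.Tendsto (fun k => t (φ k)) Filter.atTop (nhds 0) :=
    squeeze_zero (fun k => (ht0 _).le) (fun k => (ht _).le) hinv
  set e : ℕ → Fin n → ℂ := fun k =>
    (t k)⁻¹ • (U + U' * (t k • (Z₀ + t k • Z₁))) *ᵥ d k with hedef
  have helim : Filter.Tendsto (fun k => e (φ k)) Filter.atTop (nhds 0) :=
    squeeze_zero_norm (fun k => he _) hinv
  have hUe : ∀ k, (U + U' * (t k • (Z₀ + t k • Z₁))) *ᵥ d k = t k • e k := fun k => by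
    rw [hedef]
    simp only
    rw [smul_smul, mul_inv_cancel₀ (ht0 k).ne', one_smul]
  have hUa : U *ᵥ a = 0 := by
    have hcont : Continuous fun p : ℝ × (Fin n → ℂ) =>
        (U + U' * (p.1 • (Z₀ + p.1 • Z₁))) *ᵥ p.2 := by fun_prop
    have h1 := (hcont.tendsto (0, a)).comp (htlim.prodMk_nhds hlim)
    have h2 : Filter.Tendsto (fun k => t (φ k) • e (φ k)) Filter.atTop (nhds 0) := by
      simpa using htlim.smul helim
    have h3 := tendsto_nhds_unique h1 (h2.congr fun k => (hUe _).symm)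
    simpa using h3
  -- Pairing `[U; V] a` symplectically with the graph vector over `d k` and dividing by `t k` leaves
  -- only `e k` on the right; the limit gives `star a ⬝ᵥ Z₀ *ᵥ a = 0`.
  have hpairing : ∀ k, star a ⬝ᵥ (Z₀ + t k • Z₁) *ᵥ d k = -(star (V *ᵥ a) ⬝ᵥ e k) := by
    intro k
    set Y := t k • (Z₀ + t k • Z₁) with hY
    have h1 : Uᴴ * (V + V' * Y) - Vᴴ * (U + U' * Y) = Y := by
      calc Uᴴ * (V + V' * Y) - Vᴴ * (U + U' * Y)
          = (Uᴴ * V - Vᴴ * U) + (Uᴴ * V' - Vᴴ * U') * Y := by noncomm_ring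
        _ = Y := by rw [hUV, hpair, sub_self, zero_add, one_mul]
    have h2 : star a ⬝ᵥ Y *ᵥ d k = -(star (V *ᵥ a) ⬝ᵥ (t k • e k)) := by
      conv_lhs => rw [← h1]
      rw [Matrix.sub_mulVec, dotProduct_sub, ← Matrix.mulVec_mulVec, ← Matrix.mulVec_mulVec, hUe,
        Matrix.dotProduct_mulVec _ Uᴴ, ← Matrix.star_mulVec, hUa, Matrix.dotProduct_mulVec _ Vᴴ,
        ← Matrix.star_mulVec]
      simp
    rw [hY, Matrix.smul_mulVec, dotProduct_smul, dotProduct_smul, ← smul_neg] at h2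
    exact smul_right_injective ℂ (ht0 k).ne' h2
  have ha0 : star a ⬝ᵥ Z₀ *ᵥ a = 0 := by
    have hcont : Continuous fun p : ℝ × (Fin n → ℂ) =>
        star a ⬝ᵥ (Z₀ + p.1 • Z₁) *ᵥ p.2 := by fun_prop
    have hcont' : Continuous fun p : Fin n → ℂ => -(star (V *ᵥ a) ⬝ᵥ p) := by fun_prop
    have h1 := (hcont.tendsto (0, a)).comp (htlim.prodMk_nhds hlim)
    have h2 := (hcont'.tendsto 0).comp helim
    have h3 := tendsto_nhds_unique h1 (h2.congr fun k => (hpairing _).symm)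
    simpa using h3
  have := hZ₀ a ha0
  simp [this] at ha

/-- The duality relations exhibit a left inverse of `[U, U'; V, V']`. It is also a right inverse,
and the upper right block of that product is the claim. -/
theorem symplectic_identity (hUV : Uᴴ * V = Vᴴ * U) (hUV' : U'ᴴ * V' = V'ᴴ * U')
    (hpair : Uᴴ * V' - Vᴴ * U' = 1) : U' * Uᴴ = U * U'ᴴ := by
  have hpair' : V'ᴴ * U - U'ᴴ * V = 1 := by
    simpa [Matrix.conjTranspose_sub, Matrix.conjTranspose_mul] using
      congrArg Matrix.conjTranspose hpair
  have h1 : Matrix.fromBlocks V'ᴴ (-U'ᴴ) (-Vᴴ) Uᴴ * Matrix.fromBlocks U U' V V' = 1 := by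
    rw [Matrix.fromBlocks_multiply, ← Matrix.fromBlocks_one]
    simp only [Matrix.neg_mul, ← sub_eq_add_neg, neg_add_eq_sub]
    rw [hpair', hpair, hUV, hUV']
    simp
  rw [mul_eq_one_comm, Matrix.fromBlocks_multiply, ← Matrix.fromBlocks_one] at h1
  have h2 := (Matrix.fromBlocks_inj.mp h1).2.1
  rw [Matrix.mul_neg, neg_add_eq_zero] at h2
  exact h2.symm

theorem graph_isotropic (hUV : Uᴴ * V = Vᴴ * U) (hUV' : U'ᴴ * V' = V'ᴴ * U')
    (hpair : Uᴴ * V' - Vᴴ * U' = 1) (hY : Y.IsHermitian) :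
    (U + U' * Y)ᴴ * (V + V' * Y) = (V + V' * Y)ᴴ * (U + U' * Y) := by
  have hpair' : V'ᴴ * U - U'ᴴ * V = 1 := by
    simpa [Matrix.conjTranspose_sub, Matrix.conjTranspose_mul] using
      congrArg Matrix.conjTranspose hpair
  simp only [Matrix.conjTranspose_add, Matrix.conjTranspose_mul, hY.eq]
  rw [← sub_eq_zero]
  calc (Uᴴ + Y * U'ᴴ) * (V + V' * Y) - (Vᴴ + Y * V'ᴴ) * (U + U' * Y)
      = (Uᴴ * V - Vᴴ * U) + (Uᴴ * V' - Vᴴ * U') * Y - Y * (V'ᴴ * U - U'ᴴ * V)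
        + Y * (U'ᴴ * V' - V'ᴴ * U') * Y := by noncomm_ring
    _ = 0 := by rw [hUV, hUV', hpair, hpair']; simp

/-- Both blocks are invariant and isotropic, so only their mutual pairing survives; duality turns it
into the Lyapunov operator applied to `Y`. -/
theorem graph_riccati (h₁ : A * U - D * V = U * S) (h₂ : -(G * U) - Aᴴ * V = V * S)
    (h₃ : A * U' - D * V' = -(U' * Sᴴ)) (h₄ : -(G * U') - Aᴴ * V' = -(V' * Sᴴ))
    (hUV : Uᴴ * V = Vᴴ * U) (hUV' : U'ᴴ * V' = V'ᴴ * U')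
    (hpair : Uᴴ * V' - Vᴴ * U' = 1) (hY : Y.IsHermitian) :
    (V + V' * Y)ᴴ * (A * (U + U' * Y) - D * (V + V' * Y))
      + (U + U' * Y)ᴴ * (Aᴴ * (V + V' * Y) + G * (U + U' * Y)) = Sᴴ * Y + Y * S := by
  have hpair' : V'ᴴ * U - U'ᴴ * V = 1 := by
    simpa [Matrix.conjTranspose_sub, Matrix.conjTranspose_mul] using
      congrArg Matrix.conjTranspose hpair
  have e₁ : A * (U + U' * Y) - D * (V + V' * Y) = U * S - U' * Sᴴ * Y := by
    calc _ = (A * U - D * V) + (A * U' - D * V') * Y := by noncomm_ring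
      _ = _ := by rw [h₁, h₃]; noncomm_ring
  have e₂ : Aᴴ * (V + V' * Y) + G * (U + U' * Y) = -(V * S) + V' * Sᴴ * Y := by
    calc _ = -(-(G * U) - Aᴴ * V) - (-(G * U') - Aᴴ * V') * Y := by noncomm_ring
      _ = _ := by rw [h₂, h₄]; noncomm_ring
  rw [e₁, e₂]
  simp only [Matrix.conjTranspose_add, Matrix.conjTranspose_mul, hY.eq]
  calc (Vᴴ + Y * V'ᴴ) * (U * S - U' * Sᴴ * Y) + (Uᴴ + Y * U'ᴴ) * (-(V * S) + V' * Sᴴ * Y)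
      = (Vᴴ * U - Uᴴ * V) * S + (Uᴴ * V' - Vᴴ * U') * (Sᴴ * Y) + Y * (V'ᴴ * U - U'ᴴ * V) * S
        + Y * (U'ᴴ * V' - V'ᴴ * U') * (Sᴴ * Y) := by noncomm_ring
    _ = _ := by rw [hUV, hUV', hpair, hpair']; simp

/-- If the graph subspace spanned by `[X; W]` is isotropic and the Riccati form is negative
definite on it, then `W * X⁻¹` solves the Riccati inequality. -/
theorem posDef_riccati_of_graph {X W : Matrix (Fin n) (Fin n) ℂ} (hX : IsUnit X)
    (hXW : Xᴴ * W = Wᴴ * X)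
    (h : (-(Wᴴ * (A * X - D * W) + Xᴴ * (Aᴴ * W + G * X))).PosDef) :
    (W * X⁻¹).IsHermitian ∧
      (-(W * X⁻¹ * A + Aᴴ * (W * X⁻¹) + G - W * X⁻¹ * D * (W * X⁻¹))).PosDef := by
  have hdet := (Matrix.isUnit_iff_isUnit_det _).mp hX
  obtain ⟨H, hH⟩ : ∃ H, H = W * X⁻¹ := ⟨_, rfl⟩
  have hHX : H * X = W := by rw [hH, Matrix.nonsing_inv_mul_cancel_right _ _ hdet]
  have hherm : H.IsHermitian := by
    have h1 : Xᴴ * (Hᴴ - H) * X = 0 := by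
      calc Xᴴ * (Hᴴ - H) * X = (H * X)ᴴ * X - Xᴴ * (H * X) := by
            rw [Matrix.conjTranspose_mul]; noncomm_ring
        _ = 0 := by rw [hHX, hXW, sub_self]
    have h2 := (hX.mul_left_eq_zero).mp h1
    have h3 := (hX.star.mul_right_eq_zero).mp h2
    exact sub_eq_zero.mp h3
  rw [← hH]
  refine ⟨hherm, ?_⟩
  rw [← Matrix.IsUnit.posDef_star_left_conjugate_iff hX]
  have hXH : Xᴴ * H = Wᴴ := by rw [← hHX, Matrix.conjTranspose_mul, hherm.eq]
  convert h using 1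
  calc star X * -(H * A + Aᴴ * H + G - H * D * H) * X
      = -((Xᴴ * H) * (A * X - D * (H * X)) + Xᴴ * (Aᴴ * (H * X) + G * X)) := by
        rw [Matrix.star_eq_conjTranspose]; noncomm_ring
    _ = _ := by rw [hXH, hHX]

theorem isHurwitz_of_re_neg (h : ∀ x ≠ 0, (star x ⬝ᵥ S *ᵥ x).re < 0) : IsHurwitz S := by
  intro z hz
  rw [← Matrix.spectrum_toLin', ← Module.End.hasEigenvalue_iff_mem_spectrum] at hz
  obtain ⟨x, hx⟩ := hz.exists_hasEigenvector
  have h1 : S *ᵥ x = z • x := hx.apply_eq_smul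
  have h2 := h x hx.2
  have h3 : star x ⬝ᵥ x = ((∑ i, ‖x i‖ ^ 2 : ℝ) : ℂ) := by
    simp [dotProduct, Complex.conj_mul']
  rw [h1, dotProduct_smul, h3, smul_eq_mul, Complex.re_mul_ofReal] at h2
  exact neg_of_mul_neg_left h2 (Finset.sum_nonneg fun i _ => by positivity)

theorem isHurwitz_conj {X F M : Matrix (Fin n) (Fin n) ℂ} (hX : IsUnit X) (h : M * X = X * F)
    (hF : IsHurwitz F) : IsHurwitz M := by
  obtain ⟨u, rfl⟩ := hX
  have : M = u.val * F * u⁻¹.val := by rw [← h, mul_assoc, Units.mul_inv, mul_one]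
  rw [this]
  intro z hz
  rw [spectrum.units_conjugate] at hz
  exact hF z hz

end

/-! ### The stabilizing solution -/

section

open scoped Matrix.Norms.Operator

variable {n : ℕ}

theorem norm_dotProduct_mulVec_le (L : Matrix (Fin n) (Fin n) ℂ) (x : Fin n → ℂ) :
    ‖star x ⬝ᵥ L *ᵥ x‖ ≤ n * ‖L‖ * ∑ i, ‖x i‖ ^ 2 := by
  have h1 : ‖x‖ ^ 2 ≤ ∑ i, ‖x i‖ ^ 2 := by
    have h0 : 0 ≤ ∑ i, ‖x i‖ ^ 2 := Finset.sum_nonneg fun i _ => by positivity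
    rw [← Real.sq_sqrt h0]
    gcongr
    refine (pi_norm_le_iff_of_nonneg (Real.sqrt_nonneg _)).mpr fun i => Real.le_sqrt_of_sq_le ?_
    exact Finset.single_le_sum (f := fun i => ‖x i‖ ^ 2) (fun i _ => by positivity)
      (Finset.mem_univ i)
  calc ‖star x ⬝ᵥ L *ᵥ x‖ ≤ ∑ i, ‖star (x i) * (L *ᵥ x) i‖ := norm_sum_le _ _
    _ ≤ ∑ _i : Fin n, ‖L‖ * ‖x‖ ^ 2 := by
      refine Finset.sum_le_sum fun i _ => ?_
      rw [norm_mul, norm_star]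
      calc ‖x i‖ * ‖(L *ᵥ x) i‖ ≤ ‖x‖ * (‖L‖ * ‖x‖) := by
            gcongr
            · exact norm_le_pi_norm x i
            · exact (norm_le_pi_norm _ i).trans (Matrix.linfty_opNorm_mulVec L x)
        _ = _ := by ring
    _ = n * ‖L‖ * ‖x‖ ^ 2 := by simp; ring
    _ ≤ _ := by gcongr

theorem norm_le_of_mulVec_le {B : Matrix (Fin n) (Fin n) ℂ} {C : ℝ} (hC : 0 ≤ C)
    (h : ∀ x, ‖B *ᵥ x‖ ≤ C * ‖x‖) : ‖B‖ ≤ C := by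
  rw [Matrix.linfty_opNorm_eq_opNorm]
  exact ContinuousLinearMap.opNorm_le_bound _ hC h

theorem exists_stabilizing {A D G : Matrix (Fin n) (Fin n) ℂ}
    (hD : D.IsHermitian) (hG : G.IsHermitian)
    (hctrl : ∀ y, (∀ k : ℕ, D *ᵥ (Aᴴ ^ k *ᵥ y) = 0) → y = 0)
    (hR : ∀ z ∈ spectrum ℂ (Matrix.fromBlocks A (-D) (-G) (-Aᴴ)), z.re ≠ 0) :
    ∃ H : Matrix (Fin n) (Fin n) ℂ, H.IsHermitian ∧
      (-(H * A + Aᴴ * H + G - H * D * H)).PosDef ∧ IsHurwitz (A - D * H) := by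
  obtain ⟨U, V, U', V', S, hS, h₁, h₂, h₃, h₄, hUV, hUV', hpair⟩ :=
    exists_symplectic_splitting hD hG hR
  have hpair' : V'ᴴ * U - U'ᴴ * V = 1 := by
    simpa [Matrix.conjTranspose_sub, Matrix.conjTranspose_mul] using
      congrArg Matrix.conjTranspose hpair
  -- On an unobservable `c` the invariance relations reduce to `V S^k c = (-Aᴴ)^k V c` and `D V S^k
  -- c = 0`. Controllability gives `V c = 0`, and duality then `c = 0`.
  have hobs : ∀ c, (∀ k : ℕ, U *ᵥ (S ^ k *ᵥ c) = 0) → c = 0 := by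
    intro c hc
    have hA : ∀ k : ℕ, (-Aᴴ) ^ k *ᵥ (V *ᵥ c) = V *ᵥ (S ^ k *ᵥ c) := by
      intro k
      induction k with
      | zero => simp
      | succ k ih =>
        have := congrArg (· *ᵥ (S ^ k *ᵥ c)) h₂
        simp only [Matrix.sub_mulVec, Matrix.neg_mulVec, ← Matrix.mulVec_mulVec, hc,
          Matrix.mulVec_zero, neg_zero, zero_sub] at this
        rw [pow_succ', ← Matrix.mulVec_mulVec, ih, Matrix.neg_mulVec, this, pow_succ',
          ← Matrix.mulVec_mulVec]
    have hV : V *ᵥ c = 0 := hctrl _ fun k => by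
      have h5 := congrArg (· *ᵥ (S ^ k *ᵥ c)) h₁
      have h6 := hc (k + 1)
      rw [pow_succ', ← Matrix.mulVec_mulVec] at h6
      simp only [Matrix.sub_mulVec, ← Matrix.mulVec_mulVec, hc, h6,
        Matrix.mulVec_zero, zero_sub, neg_eq_zero] at h5
      rw [← hA, neg_pow] at h5
      rcases neg_one_pow_eq_or (Matrix (Fin n) (Fin n) ℂ) k with h | h
      · simpa [h] using h5
      · simpa [h, Matrix.neg_mulVec, Matrix.mulVec_neg] using h5
    have hU : U *ᵥ c = 0 := by simpa using hc 0
    have := congrArg (· *ᵥ c) hpair'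
    simpa [Matrix.sub_mulVec, ← Matrix.mulVec_mulVec, hU, hV] using this.symm
  have hQ : (Uᴴ * U).PosSemidef := Matrix.posSemidef_conjTranspose_mul_self U
  obtain ⟨Z₀, hZ₀, hL₀⟩ := hS.exists_lyapunov hQ.isHermitian.neg
  -- `Uᴴ U` is only semidefinite; the second-order term `Z₁` supplies strictness.
  obtain ⟨Z₁, hZ₁, hL₁⟩ := hS.exists_lyapunov (Q := -1) Matrix.isHermitian_one.neg
  have hpos := hS.posSemidef_of_lyapunov hZ₀ hQ hL₀
  obtain ⟨C, hC, δ, hδ, hbound⟩ := exists_mul_norm_le_norm_mulVec (Z₁ := Z₁) hUV hpair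
    (fun c hc => eq_zero_of_observable_of_lyapunov hobs hpos hL₀ hc)
  obtain ⟨ε, hε, hSε⟩ := hS
  -- A bound for `L` below, independent of `t ≤ 1`; the factor `n` in the choice of `t` comes from
  -- `norm_dotProduct_mulVec_le`.
  set K : ℝ := (‖(1 : Matrix (Fin n) (Fin n) ℂ)‖ + C * ‖U'‖ * (‖Z₀‖ + ‖Z₁‖)) * ‖U'ᴴ * U‖
    + C * ‖U'‖ with hK
  have hK0 : 0 ≤ K := by positivity
  obtain ⟨t, ht0, htδ, ht1, htε⟩ : ∃ t : ℝ, 0 < t ∧ t < δ ∧ t ≤ 1 ∧ t * (n * K) < ε := by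
    refine ⟨min (min (δ / 2) 1) (ε / (2 * (n * K + 1))), by positivity, ?_, ?_, ?_⟩
    · exact ((min_le_left _ _).trans (min_le_left _ _)).trans_lt (by linarith)
    · exact (min_le_left _ _).trans (min_le_right _ _)
    · have hnK : (0 : ℝ) ≤ n * K := by positivity
      calc _ ≤ ε / (2 * (n * K + 1)) * (n * K) := by gcongr; exact min_le_right _ _
        _ < ε := by
          rw [div_mul_eq_mul_div, div_lt_iff₀ (by positivity)]
          nlinarith [mul_nonneg hε.le hnK]
  set Z := Z₀ + t • Z₁ with hZdef
  have hZ : Z.IsHermitian := hZ₀.add (hZ₁.smul (by simp [IsSelfAdjoint]))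
  have hLZ : Sᴴ * (t • Z) + (t • Z) * S = -(t • (Uᴴ * U + t • 1)) := by
    calc Sᴴ * (t • Z) + (t • Z) * S
        = t • ((Sᴴ * Z₀ + Z₀ * S) + t • (Sᴴ * Z₁ + Z₁ * S)) := by
          rw [hZdef]
          simp only [Matrix.mul_smul, Matrix.smul_mul, Matrix.mul_add, Matrix.add_mul]
          module
      _ = _ := by rw [hL₀, hL₁]; module
  have hYherm : (t • Z).IsHermitian := hZ.smul (by simp [IsSelfAdjoint])
  set X := U + U' * (t • Z) with hX
  set W := V + V' * (t • Z) with hW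
  have hb := hbound t ht0 htδ
  have hXunit : IsUnit X := by
    rw [← Matrix.mulVec_injective_iff_isUnit]
    refine (injective_iff_map_eq_zero (Matrix.mulVecLin _)).mpr fun x hx => ?_
    rw [Matrix.mulVecLin_apply] at hx
    have := hb x
    rw [hx, norm_zero, mul_zero] at this
    exact norm_le_zero_iff.mp (nonpos_of_mul_nonpos_right this ht0)
  have hdet := (Matrix.isUnit_iff_isUnit_det _).mp hXunit
  have hpd : (t • (Uᴴ * U + t • (1 : Matrix (Fin n) (Fin n) ℂ))).PosDef :=
    (Matrix.PosDef.posSemidef_add hQ (Matrix.PosDef.one.smul ht0)).smul ht0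
  obtain ⟨hH, hHpos⟩ := posDef_riccati_of_graph (A := A) (D := D) (G := G) hXunit
    (graph_isotropic hUV hUV' hpair hYherm)
    (by rw [graph_riccati h₁ h₂ h₃ h₄ hUV hUV' hpair hYherm, hLZ, neg_neg]; exact hpd)
  refine ⟨W * X⁻¹, hH, hHpos, ?_⟩
  set B := t • X⁻¹ with hB
  have hBnorm : ‖B‖ ≤ C := norm_le_of_mulVec_le hC.le fun x => by
    have h5 := hb (X⁻¹ *ᵥ x)
    rw [Matrix.mulVec_mulVec, Matrix.mul_nonsing_inv _ hdet, Matrix.one_mulVec] at h5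
    rwa [hB, Matrix.smul_mulVec, norm_smul, Real.norm_of_nonneg ht0.le]
  -- This is `X⁻¹ U' (Uᴴ U + t)` rewritten through `U' Uᴴ = U U'ᴴ` and `U = X - t U' Z`, so that
  -- `X⁻¹` enters only via the bounded `B = t X⁻¹`.
  set L := (1 - B * U' * Z) * (U'ᴴ * U) + B * U' with hL
  have hLnorm : ‖L‖ ≤ K := by
    have hZn : ‖Z‖ ≤ ‖Z₀‖ + ‖Z₁‖ := by
      refine (norm_add_le _ _).trans ?_
      rw [norm_smul, Real.norm_of_nonneg ht0.le]
      gcongr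
      exact mul_le_of_le_one_left (norm_nonneg _) ht1
    have hBU : ‖B * U'‖ ≤ C * ‖U'‖ := (norm_mul_le _ _).trans (by gcongr)
    refine (norm_add_le _ _).trans (add_le_add ((norm_mul_le _ _).trans ?_) hBU)
    gcongr
    refine (norm_sub_le _ _).trans (add_le_add le_rfl ((norm_mul_le _ _).trans ?_))
    gcongr
  have hXB : X * B = t • 1 := by rw [hB, Matrix.mul_smul, Matrix.mul_nonsing_inv _ hdet]
  have hconj : (A - D * (W * X⁻¹)) * X = X * (S + t • L) := by
    have e₁ : (A - D * (W * X⁻¹)) * X = A * X - D * W := by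
      rw [Matrix.sub_mul, Matrix.mul_assoc D, Matrix.nonsing_inv_mul_cancel_right _ _ hdet]
    have e₂ : A * X - D * W = X * S - U' * (Sᴴ * (t • Z) + (t • Z) * S) := by
      rw [hX, hW]
      generalize t • Z = Y
      calc A * (U + U' * Y) - D * (V + V' * Y)
          = (A * U - D * V) + (A * U' - D * V') * Y := by noncomm_ring
        _ = _ := by rw [h₁, h₃]; noncomm_ring
    have e₃ : X * L = U' * Uᴴ * U + t • U' := by
      calc X * L = (X - X * B * U' * Z) * (U'ᴴ * U) + X * B * U' := by
            rw [hL]; noncomm_ring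
        _ = (X - U' * (t • Z)) * (U'ᴴ * U) + t • U' := by
            rw [hXB]; simp
        _ = _ := by
            rw [hX, add_sub_cancel_right, symplectic_identity hUV hUV' hpair, Matrix.mul_assoc]
    rw [e₁, e₂, hLZ, Matrix.mul_neg, sub_neg_eq_add, Matrix.mul_add, Matrix.mul_smul,
      Matrix.mul_smul, e₃, Matrix.mul_add, Matrix.mul_smul, Matrix.mul_one, Matrix.mul_assoc]
  refine isHurwitz_conj hXunit hconj (isHurwitz_of_re_neg fun x hx => ?_)
  rw [Matrix.add_mulVec, dotProduct_add, Complex.add_re, Matrix.smul_mulVec, dotProduct_smul,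
    Complex.smul_re, smul_eq_mul]
  have h5 := hSε x
  have h6 := sum_norm_sq_pos hx
  have h7 : (star x ⬝ᵥ L *ᵥ x).re ≤ n * K * ∑ i, ‖x i‖ ^ 2 :=
    ((Complex.re_le_norm _).trans (norm_dotProduct_mulVec_le L x)).trans (by gcongr)
  nlinarith [mul_le_mul_of_nonneg_left h7 ht0.le, mul_pos (sub_pos.mpr htε) h6]

end

theorem IsControllable.eq_zero {n : ℕ} {A D : Matrix (Fin n) (Fin n) ℂ} (hD : D.IsHermitian)
    (h : IsControllable A D) {y : Fin n → ℂ} (hy : ∀ k : ℕ, D *ᵥ (Aᴴ ^ k *ᵥ y) = 0) : y = 0 := by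
  have hrank : ((controllabilityMatrix A D)ᴴ).rank = n := by rw [Matrix.rank_conjTranspose, h]
  have hinj : Function.Injective ((controllabilityMatrix A D)ᴴ).mulVecLin := by
    rw [← LinearMap.ker_eq_bot, ← Submodule.finrank_eq_zero]
    have := LinearMap.finrank_range_add_finrank_ker ((controllabilityMatrix A D)ᴴ).mulVecLin
    rw [← Matrix.rank, hrank, Module.finrank_fin_fun] at this
    omega
  refine (injective_iff_map_eq_zero _).mp hinj y ?_
  ext ⟨k, q⟩
  have h1 : (A ^ (k : ℕ) * D)ᴴ *ᵥ y = 0 := by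
    rw [Matrix.conjTranspose_mul, hD.eq, Matrix.conjTranspose_pow, ← Matrix.mulVec_mulVec, hy]
  exact congrFun h1 q

end RiccatiInequality

theorem mainTheorem4 (n m : ℕ)
    (A : Matrix (Fin n) (Fin n) ℂ) (B : Matrix (Fin n) (Fin m) ℂ)
    (G : Matrix (Fin n) (Fin n) ℂ) (Γ : Matrix (Fin m) (Fin m) ℂ)
    (hG : G.IsHermitian) (hΓ : Γ.IsHermitian) (hdet : Γ.det ≠ 0)
    (hctrl : RiccatiInequality.IsControllable A (B * Γ⁻¹ * Bᴴ))
    (hR : ∀ z ∈ spectrum ℂ (RiccatiInequality.hamiltonian A B G Γ), z.re ≠ 0) :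
    (∃ Hminus : Matrix (Fin n) (Fin n) ℂ,
      RiccatiInequality.IsSolution A B G Γ Hminus ∧
      RiccatiInequality.IsHurwitz (A - B * Γ⁻¹ * Bᴴ * Hminus)) ∧
    (∃ Hplus : Matrix (Fin n) (Fin n) ℂ,
      RiccatiInequality.IsSolution A B G Γ Hplus ∧
      RiccatiInequality.IsHurwitz (-(A - B * Γ⁻¹ * Bᴴ * Hplus))) := by
  have hassoc : ∀ H : Matrix (Fin n) (Fin n) ℂ,
      H * B * Γ⁻¹ * Bᴴ * H = H * (B * Γ⁻¹ * Bᴴ) * H := fun H => by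
    simp only [Matrix.mul_assoc]
  unfold RiccatiInequality.IsSolution
  simp only [hassoc]
  unfold RiccatiInequality.hamiltonian at hR
  have hD : (B * Γ⁻¹ * Bᴴ).IsHermitian := Matrix.isHermitian_mul_mul_conjTranspose B hΓ.inv
  generalize B * Γ⁻¹ * Bᴴ = D at *
  constructor
  · obtain ⟨H, h1, h2, h3⟩ := RiccatiInequality.exists_stabilizing hD hG
      (fun y hy => hctrl.eq_zero hD hy) hR
    exact ⟨H, ⟨h1, h2⟩, h3⟩
  · have hctrl' : ∀ y, (∀ k : ℕ, D *ᵥ ((-A)ᴴ ^ k *ᵥ y) = 0) → y = 0 := fun y hy =>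
      hctrl.eq_zero hD fun k => by
        have h5 := hy k
        rw [Matrix.conjTranspose_neg, neg_pow] at h5
        rcases neg_one_pow_eq_or (Matrix (Fin n) (Fin n) ℂ) k with h | h
        · simpa [h] using h5
        · simpa [h, Matrix.neg_mulVec, Matrix.mulVec_neg] using h5
    have hR' : ∀ z ∈ spectrum ℂ (Matrix.fromBlocks (-A) (-D) (-G) (-(-A)ᴴ)), z.re ≠ 0 := by
      intro z hz
      -- Conjugation by `diag(1, -1)` turns the Hamiltonian matrix of `-A` into the negative of that
      -- of `A`, so its spectrum also avoids the imaginary axis.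
      let P : (Matrix (Fin n ⊕ Fin n) (Fin n ⊕ Fin n) ℂ)ˣ :=
        ⟨Matrix.fromBlocks 1 0 0 (-1), Matrix.fromBlocks 1 0 0 (-1),
          by simp [Matrix.fromBlocks_multiply], by simp [Matrix.fromBlocks_multiply]⟩
      have hP : Matrix.fromBlocks (-A) (-D) (-G) (-(-A)ᴴ)
          = -(P.val * Matrix.fromBlocks A (-D) (-G) (-Aᴴ) * P⁻¹.val) := by
        change _ = -(Matrix.fromBlocks 1 0 0 (-1) * _ * Matrix.fromBlocks 1 0 0 (-1))
        simp [Matrix.fromBlocks_multiply, Matrix.fromBlocks_neg]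
      rw [hP, ← spectrum.neg_eq, spectrum.units_conjugate, Set.mem_neg] at hz
      simpa using hR _ hz
    obtain ⟨H, h1, h2, h3⟩ := RiccatiInequality.exists_stabilizing hD hG hctrl' hR'
    refine ⟨-H, ⟨h1.neg, ?_⟩, ?_⟩
    · convert h2 using 2
      rw [Matrix.conjTranspose_neg]
      noncomm_ring
    · convert h3 using 1
      noncomm_ring
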